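/- Let $\mathcal X$ be a finite dimensional complex Hilbert space and let $A$ be an operator on $\mathcal X$ which is stable (all its eigenvalues lie in the open left half plane), dissipative ($A^*+A\le 0$), and such that $\operatorname{rank}(A^*+A)=1$. Let $$\varphi(s)=\rho\prod_{k=1}^{d}\frac{s+\overline{\alpha_k}}{s-\alpha_k},\qquad |\rho|=1,\quad \operatorname{Re}\alpha_k<0 \text{ for all } k,$$ be a Blaschke product of degree $d=\deg\varphi$ with $d<\dim\mathcal X$. For a function $f$ that is analytic on the open right half plane $\mathbb C_+$ and an operator $T$ on $\mathcal X$ with spectrum in $\mathbb C_+$, let $f(T)=\frac1{2\pi i}\oint f(z)(zI-T)^{-1}\,dz$ (a circle in $\mathbb C_+$ around the spectrum of $T$). Then the following holds. 1. There are an operator $C:\mathcal X\to\mathbb C$ with $A^*+A=-C^*C$ and a vector $x\ne 0$ in $\mathcal X$ with $x=\varphi(-A^*)^*\varphi(-A^*)x$. For every such $C$ and every such $x$, the function $s\mapsto C(sI-A)^{-1}x$ has only finitely many zeros outside the spectrum of $A$, and $$\varphi(s)=\frac{C(sI-A)^{-1}\varphi(-A^*)x}{C(sI-A)^{-1}x}$$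 for all complex $s$ outside the spectrum of $A$ with $C(sI-A)^{-1}x\neq0$. 2. If $\theta$ is a bounded analytic function on $\mathbb C_+$ such that $\theta(-A)=\varphi(-A)$ and $\|\theta\|_\infty=\sup_{\operatorname{Re}s>0}|\theta(s)|\le 1$, then $\theta(s)=\varphi(s)$ for all $s\in\mathbb C_+$. -/

import Mathlib

namespace BlaschkeInterp

open scoped ComplexConjugate

/-- The open right half plane. -/
def rightHalfPlane : Set ℂ := {s : ℂ | 0 < s.re}

/-- Membership in the scalar Hardy space `H^∞` of the open right half plane: analytic and bounded
there (values outside the open right half plane play no role). -/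
def MemHInfty (f : ℂ → ℂ) : Prop :=
  DifferentiableOn ℂ f rightHalfPlane ∧ BddAbove ((fun s => ‖f s‖) '' rightHalfPlane)

/-- The norm `‖f‖_∞ = sup {|f s| : Re s > 0}` of `H^∞`. -/
noncomputable def hInftyNorm (f : ℂ → ℂ) : ℝ :=
  sSup ((fun s => ‖f s‖) '' rightHalfPlane)

/-- The data of a finite Blaschke product
`b(s) = ρ ∏ (s + conj α_k) / (s - α_k)`, with `|ρ| = 1` and all `Re α_k < 0`. -/
structure BlaschkeProduct where
  /-- the degree, that is, the number of factors -/
  deg : ℕ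
  /-- the unimodular constant -/
  rho : ℂ
  /-- the poles, listed with multiplicity -/
  pole : Fin deg → ℂ
  norm_rho : ‖rho‖ = 1
  pole_re_neg : ∀ k, (pole k).re < 0

/-- The function of the complex variable `s` given by a Blaschke product. -/
noncomputable def BlaschkeProduct.eval (b : BlaschkeProduct) (s : ℂ) : ℂ :=
  b.rho * ∏ k, (s + conj (b.pole k)) / (s - b.pole k)

section Operators

variable {X : Type*} [NormedAddCommGroup X] [InnerProductSpace ℂ X]

/-- An operator is stable if its spectrum lies in the open left half plane. On a finite
dimensional space the spectrum is the set of eigenvalues. -/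
def IsStable (A : X →L[ℂ] X) : Prop := ∀ z ∈ spectrum ℂ A, z.re < 0

/-- `A` is dissipative if `A* + A ≤ 0`. -/
def IsDissipative [CompleteSpace X] (A : X →L[ℂ] X) : Prop :=
  ContinuousLinearMap.adjoint A + A ≤ 0

/-- The circle with centre `p.1` and radius `p.2` is an admissible contour for `T`: its closed disc
lies in the open right half plane, and the spectrum of `T` lies in its open disc. -/
def IsAdmissibleCircle (T : X →L[ℂ] X) (p : ℂ × ℝ) : Prop :=
  0 < p.2 ∧ Metric.closedBall p.1 p.2 ⊆ rightHalfPlane ∧ spectrum ℂ T ⊆ Metric.ball p.1 p.2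

open Classical in
/-- The value `f(T)` of a function `f`, analytic on the open right half plane, at an operator `T`
whose spectrum lies there, by the Riesz-Dunford integral
`f(T) = (2πi)⁻¹ ∮ f(z) (zI - T)⁻¹ dz`
over a circle in the open right half plane that winds once around the spectrum of `T`.
By Cauchy's theorem the value does not depend on the circle. -/
noncomputable def opEval (f : ℂ → ℂ) (T : X →L[ℂ] X) : X →L[ℂ] X :=
  if h : ∃ p : ℂ × ℝ, IsAdmissibleCircle T p then
    (2 * (Real.pi : ℂ) * Complex.I)⁻¹ • ∮ z in C(h.choose.1, h.choose.2), f z • resolvent T z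
  else 0

/-- An admissible circle exists as soon as the spectrum lies in the open right half plane. -/
theorem exists_isAdmissibleCircle [FiniteDimensional ℂ X] [CompleteSpace X] (T : X →L[ℂ] X)
    (hT : spectrum ℂ T ⊆ rightHalfPlane) : ∃ p : ℂ × ℝ, IsAdmissibleCircle T p := by
  have hc : IsCompact (spectrum ℂ T) := spectrum.isCompact T
  obtain ⟨ε, hε, hεT⟩ : ∃ ε : ℝ, 0 < ε ∧ ∀ z ∈ spectrum ℂ T, 2 * ε ≤ z.re := by
    rcases (spectrum ℂ T).eq_empty_or_nonempty with h | h
    · exact ⟨1, one_pos, by simp [h]⟩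
    · obtain ⟨w, hw, hmin⟩ := hc.exists_isMinOn h Complex.continuous_re.continuousOn
      have hw' : 0 < w.re := hT hw
      refine ⟨w.re / 2, by linarith, fun z hz => ?_⟩
      have : w.re ≤ z.re := hmin hz
      linarith
  obtain ⟨M, hM⟩ := hc.isBounded.exists_norm_le
  set R : ℝ := ε + 1 + M ^ 2 / ε with hR
  have hRpos : ε + 1 ≤ R := by have : 0 ≤ M ^ 2 / ε := by positivity
                               linarith
  have hRM : M ^ 2 < R * ε := by
    have : M ^ 2 / ε * ε = M ^ 2 := by field_simp
    rw [hR]; nlinarith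
  refine ⟨((R : ℂ), R - ε), by simp only; linarith, fun z hz => ?_, fun z hz => ?_⟩
  · have h1 : ‖z - R‖ ≤ R - ε := by simpa [dist_eq_norm] using hz
    have h2 := (Complex.abs_re_le_norm (z - R)).trans h1
    have h3 := (abs_le.1 h2).1
    simp only [Complex.sub_re, Complex.ofReal_re] at h3
    change 0 < z.re
    linarith
  · have h1 := hM z hz
    have h2 := hεT z hz
    have h3 : z.re * z.re + z.im * z.im ≤ M ^ 2 := by
      have := Complex.sq_norm z
      rw [Complex.normSq_apply] at this
      nlinarith [norm_nonneg z]
    rw [Metric.mem_ball, dist_eq_norm]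
    refine lt_of_pow_lt_pow_left₀ 2 (by linarith) ?_
    rw [Complex.sq_norm, Complex.normSq_apply]
    simp only [Complex.sub_re, Complex.ofReal_re, Complex.sub_im, Complex.ofReal_im, sub_zero]
    nlinarith [mul_le_mul_of_nonneg_left h2 (show 0 ≤ R by linarith), mul_pos hε hε]

end Operators

end BlaschkeInterp

namespace BlaschkeInterp

open scoped ComplexConjugate
open Metric Filter Topology Polynomial

/-! Write `B = -A*`, `q = ∏ (s - α_k)` and `p = ∏ (s + conj α_k)`, so that `φ(B) q(B) = ρ p(B)`. The
Lyapunov equation `A* + A = -C* C` gives `‖(B - α) v‖² - ‖(B + conj α) v‖² = -2 Re α ‖C v‖²`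
(`norm_sq_sub`). Exchanging factors one by one, `‖q(B) v‖² - ‖p(B) v‖²` is a nonnegative combination
of the squared moduli of `d` functionals of `v`. Hence `φ(B)` is a contraction, and as `d < dim X`
some `v ≠ 0` kills all `d` functionals; `x = q(B) v` is then fixed by `φ(B)* φ(B)`. Conversely every
such `x` arises in this way. On `ker C` the operators `B` and `A` agree, so each factor passes
through `C (s - A)⁻¹` as a scalar (`transfer_eq`); this is the quotient formula.

For uniqueness, stability makes `(C, A)` observable, so the minimal polynomial of `-A` has degree at
least `dim X > d`. It divides `θ - φ`, which thus has at least `d + 1` zeros in the half plane,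
counted with multiplicity. A maximum principle argument (`eqOn_of_sub_eq_mul`) then forces `θ = φ`.
-/

lemma isOpen_rightHalfPlane : IsOpen rightHalfPlane :=
  isOpen_lt continuous_const Complex.continuous_re

lemma convex_rightHalfPlane : Convex ℝ rightHalfPlane :=
  convex_halfSpace_re_gt 0

/-! ### Contour integral of the resolvent. -/

section BanachAlgebra

variable {𝔸 : Type*} [NormedRing 𝔸] [NormedAlgebra ℂ 𝔸]

lemma differentiableAt_resolvent [CompleteSpace 𝔸] {T : 𝔸} {z : ℂ} (hz : z ∉ spectrum ℂ T) :
    DifferentiableAt ℂ (resolvent T) z :=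
  (spectrum.hasDerivAt_resolvent_const_left (spectrum.notMem_iff.1 hz)).differentiableAt

lemma smul_resolvent {T : 𝔸} {z : ℂ} (hz : z ∉ spectrum ℂ T) :
    z • resolvent T z = T * resolvent T z + 1 := by
  have h := Ring.mul_inverse_cancel _ (spectrum.notMem_iff.1 hz)
  rw [sub_mul, ← Algebra.smul_def] at h
  rw [resolvent, ← h]
  abel

lemma mul_circleIntegral [CompleteSpace 𝔸] (a : 𝔸) {f : ℂ → 𝔸} {c : ℂ} {R : ℝ}
    (hf : CircleIntegrable f c R) :
    ∮ z in C(c, R), a * f z = a * ∮ z in C(c, R), f z := by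
  have h := ((ContinuousLinearMap.mul ℂ 𝔸) a).intervalIntegral_comp_comm hf.out
  simpa [circleIntegral] using h

lemma continuousOn_resolvent_sphere [CompleteSpace 𝔸] {T : 𝔸} {c : ℂ} {R : ℝ} (hT : spectrum ℂ T ⊆ ball c R) :
    ContinuousOn (resolvent T) (sphere c R) := fun z hz =>
  (differentiableAt_resolvent fun h => by
    have := hT h
    rw [mem_sphere] at hz
    rw [mem_ball] at this
    linarith).continuousAt.continuousWithinAt

/-- The resolvent is `(z - c)⁻¹` plus a remainder `g = o(1/|z|)` that is analytic outside the disc.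
The integral of `g` does not depend on the radius and tends to zero as the radius grows. -/
lemma circleIntegral_resolvent [CompleteSpace 𝔸] {T : 𝔸} {c : ℂ} {R : ℝ} (hR : 0 < R)
    (hT : spectrum ℂ T ⊆ ball c R) :
    ∮ z in C(c, R), resolvent T z = (2 * (Real.pi : ℂ) * Complex.I) • (1 : 𝔸) := by
  have hns : ∀ z, R ≤ dist z c → z ∉ spectrum ℂ T := fun z hz h => by
    have := hT h
    rw [mem_ball] at this
    linarith
  set a : 𝔸 := T - algebraMap ℂ 𝔸 c with ha
  set g : ℂ → 𝔸 := fun z => (z - c)⁻¹ • (a * resolvent T z) with hg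
  have hne : ∀ z, R ≤ dist z c → z - c ≠ 0 := fun z hz h => by
    rw [dist_eq_norm, h, norm_zero] at hz
    linarith
  have hgd : ∀ z, R ≤ dist z c → DifferentiableAt ℂ g z := fun z hz =>
    ((differentiableAt_id.sub_const c).inv (hne z hz)).smul
      ((differentiableAt_resolvent (hns z hz)).const_mul a)
  have hsplit : ∀ z, R ≤ dist z c → resolvent T z = (z - c)⁻¹ • (1 : 𝔸) + g z := fun z hz => by
    have h := smul_resolvent (hns z hz)
    rw [hg, ← smul_add, eq_inv_smul_iff₀ (hne z hz), sub_smul, h, ha, sub_mul,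
      ← Algebra.smul_def]
    abel
  have hconst : ∀ r, R ≤ r → ∮ z in C(c, r), g z = ∮ z in C(c, R), g z := fun r hr =>
    Complex.circleIntegral_eq_of_differentiable_on_annulus_off_countable hR hr
      Set.countable_empty
      (fun z hz => (hgd z (by simpa using hz.2)).continuousAt.continuousWithinAt)
      (fun z hz => hgd z (by have := hz.1.2; simp at this; exact this.le))
  have hzero : ∮ z in C(c, R), g z = 0 := by
    have hlim : Tendsto (fun z => a * resolvent T z) (Bornology.cobounded ℂ) (𝓝 0) := by
      simpa using (spectrum.resolvent_tendsto_cobounded T).const_mul a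
    rw [← norm_le_zero_iff]
    refine le_of_forall_pos_le_add fun ε hε => ?_
    -- The factor `2π` is absorbed here: on a circle of radius `r` the length `2πr` times `r⁻¹ ε /
    -- (2π)` is `ε`.
    have hev := (Metric.tendsto_nhds.1 hlim) (ε / (2 * Real.pi)) (by positivity)
    rw [← comap_dist_right_atTop c, eventually_comap, eventually_atTop] at hev
    obtain ⟨M, hM⟩ := hev
    set r := max R M
    have hr : 0 < r := hR.trans_le (le_max_left _ _)
    rw [← hconst r (le_max_left _ _)]
    have := circleIntegral.norm_integral_le_of_norm_le_const (f := g) (c := c) (R := r)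
      (C := r⁻¹ * (ε / (2 * Real.pi))) hr.le (fun z hz => by
        have h1 := hM r (le_max_right _ _) z hz
        rw [dist_zero_right] at h1
        rw [hg, norm_smul, norm_inv, ← dist_eq_norm, hz]
        gcongr)
    refine this.trans (le_of_eq ?_)
    field_simp
    ring
  have hsphere : ∀ z ∈ sphere c R, R ≤ dist z c := fun z hz => (mem_sphere.1 hz).ge
  rw [circleIntegral.integral_congr hR.le (fun z hz => hsplit z (hsphere z hz)),
    circleIntegral.integral_add, hzero, circleIntegral.integral_smul_const,
    circleIntegral.integral_sub_center_inv c hR.ne', add_zero]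
  · refine ContinuousOn.circleIntegrable hR.le fun z hz => ContinuousAt.continuousWithinAt ?_
    have := hne z (hsphere z hz)
    fun_prop (disch := assumption)
  · exact ContinuousOn.circleIntegrable hR.le fun z hz =>
      (hgd z (hsphere z hz)).continuousAt.continuousWithinAt

end BanachAlgebra

/-! ### The Riesz-Dunford calculus as a module over polynomials. -/

section RieszDunford

variable {X : Type*} [NormedAddCommGroup X] [InnerProductSpace ℂ X] [CompleteSpace X]
  {T : X →L[ℂ] X}

/-- The chosen circle depends on `T` only, so one contour serves all functions at once and its
independence of the choice is never needed. -/
lemma exists_circle_opEval [FiniteDimensional ℂ X] (hT : spectrum ℂ T ⊆ rightHalfPlane) :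
    ∃ (c : ℂ) (R : ℝ), IsAdmissibleCircle T (c, R) ∧ ∀ f : ℂ → ℂ, opEval f T =
      (2 * (Real.pi : ℂ) * Complex.I)⁻¹ • ∮ z in C(c, R), f z • resolvent T z := by
  have h := exists_isAdmissibleCircle T hT
  exact ⟨h.choose.1, h.choose.2, h.choose_spec, fun f => by rw [opEval, dif_pos h]⟩

lemma opEval_congr [FiniteDimensional ℂ X] (hT : spectrum ℂ T ⊆ rightHalfPlane) {f g : ℂ → ℂ}
    (hfg : Set.EqOn f g rightHalfPlane) : opEval f T = opEval g T := by
  obtain ⟨c, R, ⟨hR, hcR, -⟩, hop⟩ := exists_circle_opEval hT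
  rw [hop, hop]
  congr 1
  exact circleIntegral.integral_congr hR.le fun z hz => by
    simp only [hfg (hcR (sphere_subset_closedBall hz))]

lemma IsAdmissibleCircle.circleIntegrable {c : ℂ} {R : ℝ} (h : IsAdmissibleCircle T (c, R))
    {f : ℂ → ℂ} (hf : DifferentiableOn ℂ f rightHalfPlane) :
    CircleIntegrable (fun z => f z • resolvent T z) c R :=
  ContinuousOn.circleIntegrable h.1.le
    ((hf.continuousOn.mono (sphere_subset_closedBall.trans h.2.1)).smul
      (continuousOn_resolvent_sphere h.2.2))

lemma opEval_add [FiniteDimensional ℂ X] (hT : spectrum ℂ T ⊆ rightHalfPlane) {f g : ℂ → ℂ}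
    (hf : DifferentiableOn ℂ f rightHalfPlane) (hg : DifferentiableOn ℂ g rightHalfPlane) :
    opEval (fun z => f z + g z) T = opEval f T + opEval g T := by
  obtain ⟨c, R, h, hop⟩ := exists_circle_opEval hT
  simp only [hop, add_smul]
  rw [circleIntegral.integral_add (h.circleIntegrable hf) (h.circleIntegrable hg), smul_add]

lemma opEval_const_mul [FiniteDimensional ℂ X] (hT : spectrum ℂ T ⊆ rightHalfPlane)
    (a : ℂ) (f : ℂ → ℂ) :
    opEval (fun z => a * f z) T = a • opEval f T := by
  obtain ⟨c, R, -, hop⟩ := exists_circle_opEval hT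
  simp only [hop, mul_smul]
  rw [circleIntegral.integral_smul, smul_comm]

/-- Since `z (z - T)⁻¹ = T (z - T)⁻¹ + 1`, the two sides differ by a multiple of `∮ f = 0`. -/
lemma opEval_id_mul [FiniteDimensional ℂ X] (hT : spectrum ℂ T ⊆ rightHalfPlane) {f : ℂ → ℂ}
    (hf : DifferentiableOn ℂ f rightHalfPlane) :
    opEval (fun z => z * f z) T = T * opEval f T := by
  obtain ⟨c, R, h, hop⟩ := exists_circle_opEval hT
  have hfR : ContinuousOn f (closedBall c R) := hf.continuousOn.mono h.2.1
  have hcauchy : ∮ z in C(c, R), f z • (1 : X →L[ℂ] X) = 0 := by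
    rw [circleIntegral.integral_smul_const,
      Complex.circleIntegral_eq_zero_of_differentiable_on_off_countable h.1.le
        Set.countable_empty hfR (fun z hz => (hf.differentiableAt
          (isOpen_rightHalfPlane.mem_nhds (h.2.1 (ball_subset_closedBall hz.1))))), zero_smul]
  have hsplit : Set.EqOn (fun z => (z * f z) • resolvent T z)
      (fun z => T * (f z • resolvent T z) + f z • 1) (sphere c R) := fun z hz => by
    have hz' : z ∉ spectrum ℂ T := fun hs => (mem_ball.1 (h.2.2 hs)).ne hz
    simp only
    rw [mul_comm, mul_smul, smul_resolvent hz', smul_add, mul_smul_comm]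
  rw [hop, hop, circleIntegral.integral_congr h.1.le hsplit, circleIntegral.integral_add,
    hcauchy, add_zero, mul_circleIntegral T (h.circleIntegrable hf), mul_smul_comm]
  · have := h.circleIntegrable hf
    exact ContinuousOn.circleIntegrable h.1.le (continuousOn_const.mul
      ((hfR.mono sphere_subset_closedBall).smul (continuousOn_resolvent_sphere h.2.2)))
  · exact ContinuousOn.circleIntegrable h.1.le
      ((hfR.mono sphere_subset_closedBall).smul continuousOn_const)

lemma opEval_one [FiniteDimensional ℂ X] (hT : spectrum ℂ T ⊆ rightHalfPlane) :
    opEval (fun _ => 1) T = 1 := by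
  obtain ⟨c, R, h, hop⟩ := exists_circle_opEval hT
  simp only [hop, one_smul]
  rw [circleIntegral_resolvent h.1 h.2.2, smul_smul, inv_mul_cancel₀ Complex.two_pi_I_ne_zero,
    one_smul]

/-- The Riesz-Dunford calculus is linear over polynomials. -/
lemma opEval_polynomial_mul [FiniteDimensional ℂ X] (hT : spectrum ℂ T ⊆ rightHalfPlane)
    (p : ℂ[X]) {f : ℂ → ℂ}
    (hf : DifferentiableOn ℂ f rightHalfPlane) :
    opEval (fun z => p.eval z * f z) T = aeval T p * opEval f T := by
  induction p using Polynomial.induction_on with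
  | C a => simp [opEval_const_mul hT, Algebra.algebraMap_eq_smul_one]
  | add p q hp hq =>
    simp only [eval_add, add_mul, map_add]
    rw [← hp, ← hq]
    exact opEval_add hT (p.differentiable.differentiableOn.mul hf)
      (q.differentiable.differentiableOn.mul hf)
  | monomial n a h =>
    have h' : (fun z => (C a * Polynomial.X ^ (n + 1) : ℂ[X]).eval z * f z) =
        fun z => z * ((C a * Polynomial.X ^ n : ℂ[X]).eval z * f z) := by
      funext z
      simp only [eval_mul, eval_C, eval_pow, eval_X]
      ring
    have h'' := opEval_id_mul hT ((C a * Polynomial.X ^ n).differentiable.differentiableOn.mul hf)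
    refine (congrArg (opEval · T) h').trans (h''.trans ?_)
    refine (congrArg (T * ·) h).trans ?_
    rw [← mul_assoc]
    congr 1
    rw [pow_succ', mul_left_comm, map_mul (aeval T) Polynomial.X, aeval_X]

lemma opEval_polynomial [FiniteDimensional ℂ X] (hT : spectrum ℂ T ⊆ rightHalfPlane)
    (p : ℂ[X]) :
    opEval (fun z => p.eval z) T = aeval T p := by
  simpa [opEval_one hT] using
    opEval_polynomial_mul hT p (f := fun _ => 1) (differentiableOn_const 1)

end RieszDunford

/-- The polynomial `∏ (s + conj α_k)`, up to a constant the numerator of a Blaschke product with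
poles `α_k`. -/
noncomputable def numPoly {d : ℕ} (α : Fin d → ℂ) : ℂ[X] :=
  ∏ k, (Polynomial.X + C (conj (α k)))

/-- The polynomial `∏ (s - α_k)`, the denominator of a Blaschke product with poles `α_k`. -/
noncomputable def denPoly {d : ℕ} (α : Fin d → ℂ) : ℂ[X] :=
  ∏ k, (Polynomial.X - C (α k))

lemma numPoly_succ {d : ℕ} (α : Fin (d + 1) → ℂ) :
    numPoly α = (Polynomial.X + C (conj (α 0))) * numPoly fun k => α k.succ :=
  Fin.prod_univ_succ _

lemma denPoly_succ {d : ℕ} (α : Fin (d + 1) → ℂ) :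
    denPoly α = (Polynomial.X - C (α 0)) * denPoly fun k => α k.succ :=
  Fin.prod_univ_succ _

lemma eval_numPoly {d : ℕ} (α : Fin d → ℂ) (s : ℂ) :
    (numPoly α).eval s = ∏ k, (s + conj (α k)) := by
  simp [numPoly, eval_prod]

lemma eval_denPoly {d : ℕ} (α : Fin d → ℂ) (s : ℂ) :
    (denPoly α).eval s = ∏ k, (s - α k) := by
  simp [denPoly, eval_prod]

lemma isUnit_aeval_prod {𝔸 ι : Type*} [Ring 𝔸] [Algebra ℂ 𝔸] {T : 𝔸} (t : Finset ι) (a : ι → ℂ)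
    (h : ∀ i ∈ t, a i ∉ spectrum ℂ T) :
    IsUnit (aeval T (∏ i ∈ t, (Polynomial.X - C (a i)))) := by
  refine Finset.prod_induction _ (fun p => IsUnit (aeval T p)) (fun p q hp hq => ?_) ?_
    fun i hi => ?_
  · rw [map_mul]
    exact hp.mul hq
  · simp
  · have := (spectrum.notMem_iff.1 (h i hi)).neg
    simpa using this

/-! ### The Lyapunov identity and extremal vectors. -/

section Operators

variable {X : Type*} [NormedAddCommGroup X] [InnerProductSpace ℂ X]

lemma injective_of_isUnit {T : X →L[ℂ] X} (hT : IsUnit T) {v : X} (hv : T v = 0) : v = 0 := by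
  obtain ⟨u, rfl⟩ := hT
  calc v = (↑u⁻¹ : X →L[ℂ] X) ((u : X →L[ℂ] X) v) :=
        (congrArg (fun S : X →L[ℂ] X => S v) u.inv_mul).symm
    _ = 0 := by rw [hv, map_zero]

lemma exists_of_isUnit {T : X →L[ℂ] X} (hT : IsUnit T) (x : X) : ∃ v, T v = x := by
  obtain ⟨u, rfl⟩ := hT
  exact ⟨(↑u⁻¹ : X →L[ℂ] X) x, congrArg (fun S : X →L[ℂ] X => S x) u.mul_inv⟩

lemma resolvent_apply_sub {A : X →L[ℂ] X} {s : ℂ} (hs : s ∉ spectrum ℂ A) (u : X) :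
    resolvent A s (s • u - A u) = u := by
  have h := Ring.inverse_mul_cancel _ (spectrum.notMem_iff.1 hs)
  simpa [resolvent, Algebra.algebraMap_eq_smul_one] using
    congrArg (fun S : X →L[ℂ] X => S u) h

lemma mem_spectrum_of_apply_eq_smul {A : X →L[ℂ] X} {c : ℂ} {v : X} (hv : v ≠ 0)
    (h : A v = c • v) : c ∈ spectrum ℂ A := by
  by_contra hc
  have := resolvent_apply_sub hc v
  rw [h, sub_self, map_zero] at this
  exact hv this.symm

variable [CompleteSpace X]

/-- `A` and `C` satisfy the Lyapunov equation `A* + A = -C* C`. -/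
def LyapunovEq (A : X →L[ℂ] X) (C : X →L[ℂ] ℂ) : Prop :=
  ContinuousLinearMap.adjoint A + A = -(ContinuousLinearMap.adjoint C ∘L C)

variable {A : X →L[ℂ] X} {C' : X →L[ℂ] ℂ}

lemma LyapunovEq.adjoint_apply (h : LyapunovEq A C') (v : X) :
    -ContinuousLinearMap.adjoint A v = A v + ContinuousLinearMap.adjoint C' (C' v) := by
  have := congrArg (fun S : X →L[ℂ] X => S v) h
  simp only [add_apply, neg_apply,
    ContinuousLinearMap.comp_apply] at this
  rw [eq_neg_iff_add_eq_zero] at this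
  rw [neg_eq_iff_add_eq_zero, ← this]
  abel

lemma LyapunovEq.two_re_inner (h : LyapunovEq A C') (v : X) :
    2 * (inner ℂ v (A v)).re = -‖C' v‖ ^ 2 := by
  have h1 := congrArg (fun w => (inner ℂ v w).re) (h.adjoint_apply v)
  simp only [inner_neg_right, inner_add_right, ContinuousLinearMap.adjoint_inner_right,
    Complex.neg_re, Complex.add_re] at h1
  rw [← inner_conj_symm (A v) v, Complex.conj_re] at h1
  have h2 : (inner ℂ (C' v) (C' v)).re = ‖C' v‖ ^ 2 := by
    rw [inner_self_eq_norm_sq_to_K]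
    norm_cast
  linarith

/-- The terms in `|α|²` cancel, and the cross terms add up to a multiple of `Re ⟨v, A v⟩`, which is
`-‖C v‖² / 2`. -/
lemma LyapunovEq.norm_sq_sub (h : LyapunovEq A C') (α : ℂ) (v : X) :
    ‖aeval (-ContinuousLinearMap.adjoint A) (Polynomial.X - C α) v‖ ^ 2 -
      ‖aeval (-ContinuousLinearMap.adjoint A) (Polynomial.X + C (conj α)) v‖ ^ 2 =
      -2 * α.re * ‖C' v‖ ^ 2 := by
  have e1 : aeval (-ContinuousLinearMap.adjoint A) (Polynomial.X - C α) v =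
      -ContinuousLinearMap.adjoint A v - α • v := by
    simp [Algebra.algebraMap_eq_smul_one]
  have e2 : aeval (-ContinuousLinearMap.adjoint A) (Polynomial.X + C (conj α)) v =
      -ContinuousLinearMap.adjoint A v + conj α • v := by
    simp [Algebra.algebraMap_eq_smul_one]
  have e3 := h.two_re_inner v
  have e4 : inner ℂ (ContinuousLinearMap.adjoint A v) v = inner ℂ v (A v) :=
    ContinuousLinearMap.adjoint_inner_left _ _ _
  rw [e1, e2, @norm_sub_sq ℂ, @norm_add_sq ℂ, norm_smul, norm_smul, RCLike.norm_conj,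
    inner_smul_right, inner_smul_right, inner_neg_left, e4]
  simp only [RCLike.re_to_complex, Complex.mul_re, Complex.neg_re, Complex.neg_im,
    Complex.conj_re, Complex.conj_im]
  linear_combination 2 * α.re * e3

lemma LyapunovEq.norm_numPoly_le (h : LyapunovEq A C') {d : ℕ} (α : Fin d → ℂ)
    (hα : ∀ k, (α k).re < 0) (v : X) :
    ‖aeval (-ContinuousLinearMap.adjoint A) (numPoly α) v‖ ^ 2 ≤
      ‖aeval (-ContinuousLinearMap.adjoint A) (denPoly α) v‖ ^ 2 := by
  induction d generalizing v with
  | zero => simp [numPoly, denPoly]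
  | succ d ih =>
    have h1 := ih (fun k => α k.succ) (fun k => hα _)
      (aeval (-ContinuousLinearMap.adjoint A) (Polynomial.X - C (α 0)) v)
    have h2 := h.norm_sq_sub (α 0)
      (aeval (-ContinuousLinearMap.adjoint A) (numPoly fun k => α k.succ) v)
    simp only [← mul_apply_eq_comp, ← map_mul] at h1 h2
    rw [numPoly_succ, denPoly_succ, mul_comm (Polynomial.X - C (α 0))]
    rw [mul_comm (numPoly fun k => α k.succ)] at h1
    nlinarith [mul_nonneg (neg_nonneg.2 (hα 0).le)
      (sq_nonneg ‖C' (aeval (-ContinuousLinearMap.adjoint A) (numPoly fun k => α k.succ) v)‖)]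

/-- Equality of norms is the vanishing of `d` functionals. -/
lemma LyapunovEq.exists_functionals (h : LyapunovEq A C') {d : ℕ} (α : Fin d → ℂ) :
    ∃ l : Fin d → (X →ₗ[ℂ] ℂ), ∀ v, (∀ k, l k v = 0) →
      ‖aeval (-ContinuousLinearMap.adjoint A) (numPoly α) v‖ ^ 2 =
        ‖aeval (-ContinuousLinearMap.adjoint A) (denPoly α) v‖ ^ 2 := by
  induction d with
  | zero => exact ⟨fun _ => 0, fun v _ => by simp [numPoly, denPoly]⟩
  | succ d ih =>
    obtain ⟨l, hl⟩ := ih fun k => α k.succ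
    -- The head is the defect of exchanging the factor of `α 0` after the other numerator factors;
    -- the tail lives at the vector `(B - α 0) v`.
    refine ⟨Fin.cons
      (C' ∘L aeval (-ContinuousLinearMap.adjoint A) (numPoly fun k => α k.succ)).toLinearMap
      (fun k => l k ∘ₗ
        (aeval (-ContinuousLinearMap.adjoint A) (Polynomial.X - C (α 0))).toLinearMap),
      fun v hv => ?_⟩
    have h0 := hv 0
    simp only [Fin.cons_zero, ContinuousLinearMap.coe_coe,
      ContinuousLinearMap.comp_apply] at h0
    have h1 := hl (aeval (-ContinuousLinearMap.adjoint A) (Polynomial.X - C (α 0)) v)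
      fun k => by simpa using hv k.succ
    have h2 := h.norm_sq_sub (α 0)
      (aeval (-ContinuousLinearMap.adjoint A) (numPoly fun k => α k.succ) v)
    rw [h0, norm_zero] at h2
    simp only [← mul_apply_eq_comp, ← map_mul] at h1 h2
    rw [mul_comm (numPoly fun k => α k.succ)] at h1
    rw [numPoly_succ, denPoly_succ, mul_comm (Polynomial.X - C (α 0))]
    linarith

/-- On `ker C` one has `B u = A u`, so `(B - β) u = (s - β) u - (s - A) u`, and the last term
contributes `C u = 0` after the resolvent. -/
lemma LyapunovEq.transfer_factor (h : LyapunovEq A C') (α : ℂ) {u : X} (hu : C' u = 0) {s : ℂ}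
    (hs : s ∉ spectrum ℂ A) :
    (s - α) * C' (resolvent A s
        (aeval (-ContinuousLinearMap.adjoint A) (Polynomial.X + C (conj α)) u)) =
      (s + conj α) * C' (resolvent A s
        (aeval (-ContinuousLinearMap.adjoint A) (Polynomial.X - C α) u)) := by
  have key : ∀ β : ℂ, C' (resolvent A s
      (aeval (-ContinuousLinearMap.adjoint A) (Polynomial.X - C β) u)) =
        (s - β) * C' (resolvent A s u) := fun β => by
    have e1 : aeval (-ContinuousLinearMap.adjoint A) (Polynomial.X - C β) u =
        (s - β) • u - (s • u - A u) := by
      have := h.adjoint_apply u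
      rw [hu, map_zero, add_zero] at this
      simp only [map_sub, aeval_X, aeval_C, Algebra.algebraMap_eq_smul_one,
        sub_apply, neg_apply, this,
        smul_apply, one_apply_eq_self, sub_smul]
      abel
    rw [e1, map_sub, resolvent_apply_sub hs, map_sub, hu, map_smul, map_smul, sub_zero,
      smul_eq_mul]
  have := key (-conj α)
  rw [map_neg, sub_neg_eq_add, sub_neg_eq_add] at this
  rw [this, key]
  ring

/-- Extremal vectors: multiplication by a Blaschke product on the transfer functions. -/
lemma LyapunovEq.transfer_eq (h : LyapunovEq A C') {d : ℕ} (α : Fin d → ℂ)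
    (hα : ∀ k, (α k).re < 0) {v : X}
    (hv : ‖aeval (-ContinuousLinearMap.adjoint A) (numPoly α) v‖ ^ 2 =
      ‖aeval (-ContinuousLinearMap.adjoint A) (denPoly α) v‖ ^ 2)
    {s : ℂ} (hs : s ∉ spectrum ℂ A) :
    (denPoly α).eval s *
        C' (resolvent A s (aeval (-ContinuousLinearMap.adjoint A) (numPoly α) v)) =
      (numPoly α).eval s *
        C' (resolvent A s (aeval (-ContinuousLinearMap.adjoint A) (denPoly α) v)) := by
  induction d generalizing v with
  | zero => simp [numPoly, denPoly]
  | succ d ih =>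
    have h1 := h.norm_numPoly_le (fun k => α k.succ) (fun k => hα _)
      (aeval (-ContinuousLinearMap.adjoint A) (Polynomial.X - C (α 0)) v)
    have h2 := h.norm_sq_sub (α 0)
      (aeval (-ContinuousLinearMap.adjoint A) (numPoly fun k => α k.succ) v)
    have h3 := mul_nonneg (neg_nonneg.2 (hα 0).le)
      (sq_nonneg ‖C' (aeval (-ContinuousLinearMap.adjoint A) (numPoly fun k => α k.succ) v)‖)
    have ih' := ih (fun k => α k.succ) (fun k => hα _)
      (v := aeval (-ContinuousLinearMap.adjoint A) (Polynomial.X - C (α 0)) v)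
    rw [numPoly_succ, denPoly_succ, mul_comm (Polynomial.X - C (α 0))] at hv
    simp only [← mul_apply_eq_comp (aeval (-ContinuousLinearMap.adjoint A) _),
      ← map_mul] at h1 h2 ih'
    rw [mul_comm (numPoly fun k => α k.succ)] at h1 ih'
    -- The total defect vanishes and is a sum of nonnegative terms, so each term vanishes.
    have h4 : C' (aeval (-ContinuousLinearMap.adjoint A) (numPoly fun k => α k.succ) v) = 0 := by
      have h5 : -(α 0).re *
          ‖C' (aeval (-ContinuousLinearMap.adjoint A) (numPoly fun k => α k.succ) v)‖ ^ 2 = 0 := by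
        linarith
      simpa [(hα 0).ne] using h5
    have h6 := h.transfer_factor (α 0) h4 hs
    rw [h4, norm_zero] at h2
    have h7 := ih' (by linarith)
    simp only [← mul_apply_eq_comp (aeval (-ContinuousLinearMap.adjoint A) _),
      ← map_mul] at h6
    rw [numPoly_succ, denPoly_succ]
    rw [mul_comm (denPoly fun k => α k.succ)] at h7
    simp only [eval_mul, eval_add, eval_sub, eval_X, eval_C]
    linear_combination (denPoly fun k => α k.succ).eval s * h6 + (s + conj (α 0)) * h7

/-- Expand: `‖x - T* T x‖² = ‖x‖² - 2 ‖T x‖² + ‖T* T x‖² ≤ 0`. -/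
lemma eq_adjoint_apply_of_norm_eq {T : X →L[ℂ] X} (hT : ∀ x, ‖T x‖ ≤ ‖x‖) {x : X}
    (hx : ‖T x‖ = ‖x‖) : x = ContinuousLinearMap.adjoint T (T x) := by
  have h1 : ‖ContinuousLinearMap.adjoint T (T x)‖ ≤ ‖x‖ := by
    have h2 : ‖ContinuousLinearMap.adjoint T‖ ≤ 1 := by
      rw [LinearIsometryEquiv.norm_map]
      exact T.opNorm_le_bound zero_le_one fun x => by simpa using hT x
    exact ((ContinuousLinearMap.adjoint T).le_of_opNorm_le h2 _).trans (by rw [one_mul, hx])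
  have h3 : ‖x - ContinuousLinearMap.adjoint T (T x)‖ ^ 2 ≤ 0 := by
    rw [@norm_sub_sq ℂ, ContinuousLinearMap.adjoint_inner_right, inner_self_eq_norm_sq, hx]
    nlinarith [norm_nonneg (ContinuousLinearMap.adjoint T (T x)), norm_nonneg x]
  rw [← sub_eq_zero, ← norm_eq_zero]
  exact pow_eq_zero_iff two_ne_zero |>.1 (le_antisymm h3 (sq_nonneg _))

lemma norm_eq_of_eq_adjoint_apply {T : X →L[ℂ] X} {x : X}
    (hx : x = ContinuousLinearMap.adjoint T (T x)) : ‖T x‖ ^ 2 = ‖x‖ ^ 2 := by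
  rw [← @inner_self_eq_norm_sq ℂ, ← ContinuousLinearMap.adjoint_inner_left, ← hx,
    inner_self_eq_norm_sq]

end Operators

/-! ### Observability and the rank one factorisation. -/

section Operators

variable {X : Type*} [NormedAddCommGroup X] [InnerProductSpace ℂ X]
  {A : X →L[ℂ] X} {C' : X →L[ℂ] ℂ}

lemma IsStable.neg_spectrum_subset (hA : IsStable A) : spectrum ℂ (-A) ⊆ rightHalfPlane := by
  intro z hz
  rw [← spectrum.neg_eq, Set.mem_neg] at hz
  have := hA _ hz
  simpa [rightHalfPlane] using this

lemma isIntegral_continuousLinearMap [FiniteDimensional ℂ X] (A : X →L[ℂ] X) : IsIntegral ℂ A :=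
  Algebra.IsIntegral.isIntegral A

variable [CompleteSpace X]

lemma IsStable.adjoint (hA : IsStable A) : IsStable (ContinuousLinearMap.adjoint A) := by
  intro z hz
  rw [← ContinuousLinearMap.star_eq_adjoint, spectrum.map_star, Set.mem_star] at hz
  simpa using hA _ hz

variable [FiniteDimensional ℂ X]

/-- The pair `(C, A)` is observable. -/
lemma LyapunovEq.eq_bot_of_invariant (h : LyapunovEq A C') (hA : IsStable A) (V : Submodule ℂ X)
    (hV : ∀ v ∈ V, A v ∈ V) (hC : ∀ v ∈ V, C' v = 0) : V = ⊥ := by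
  by_contra hne
  have : Nontrivial V := (Submodule.nontrivial_iff_ne_bot).2 hne
  obtain ⟨c, hc⟩ := Module.End.exists_eigenvalue (A.toLinearMap.restrict hV)
  obtain ⟨v, hv⟩ := hc.exists_hasEigenvector
  have hAv : A (v : X) = c • (v : X) := by
    have := congrArg (Subtype.val) hv.apply_eq_smul
    simpa using this
  have hv0 : (v : X) ≠ 0 := by simpa using hv.2
  -- An eigenvector in `ker C` would have a purely imaginary eigenvalue, against stability.
  have h1 := h.two_re_inner (v : X)
  rw [hC _ v.2, hAv, inner_smul_right, inner_self_eq_norm_sq_to_K] at h1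
  have h2 := hA c (mem_spectrum_of_apply_eq_smul hv0 hAv)
  have h3 : (c * (Complex.ofReal ‖(v : X)‖) ^ 2).re = c.re * ‖(v : X)‖ ^ 2 := by
    rw [← Complex.ofReal_pow, Complex.re_mul_ofReal]
  have h4 : 2 * (c.re * ‖(v : X)‖ ^ 2) = 0 := by
    rw [← h3]
    simpa using h1
  simp [h2.ne, norm_ne_zero_iff.2 hv0] at h4

lemma LyapunovEq.eq_zero_of_observations (h : LyapunovEq A C') (hA : IsStable A) {x : X}
    (hx : ∀ p : ℂ[X], p.degree < (minpoly ℂ A).natDegree → C' (aeval A p x) = 0) : x = 0 := by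
  have hall : ∀ p : ℂ[X], C' (aeval A p x) = 0 := fun p => by
    have hmon := minpoly.monic (isIntegral_continuousLinearMap A)
    rw [← Polynomial.aeval_modByMonic_eq_self_of_root (minpoly.aeval ℂ A)]
    refine hx _ ?_
    rw [← degree_eq_natDegree hmon.ne_zero]
    exact degree_modByMonic_lt p hmon
  -- The unobservable subspace: invariant under `A` and contained in `ker C`.
  let V : Submodule ℂ X :=
    { carrier := {v | ∀ p : ℂ[X], C' (aeval A p v) = 0}
      add_mem' := fun ha hb p => by rw [map_add, map_add, ha, hb, add_zero]
      zero_mem' := fun p => by rw [map_zero, map_zero]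
      smul_mem' := fun c v hv p => by rw [map_smul, map_smul, hv, smul_zero] }
  have hV : V = ⊥ := h.eq_bot_of_invariant hA V
    (fun v hv p => by
      have := hv (p * Polynomial.X)
      rwa [map_mul, aeval_X, mul_apply_eq_comp] at this)
    (fun v hv => by simpa using hv 1)
  have hxV : x ∈ V := hall
  rwa [hV, Submodule.mem_bot] at hxV

/-- `A` is nonderogatory. -/
lemma LyapunovEq.finrank_le_natDegree_minpoly (h : LyapunovEq A C') (hA : IsStable A) :
    Module.finrank ℂ X ≤ (minpoly ℂ A).natDegree := by
  let l : X →ₗ[ℂ] (Fin (minpoly ℂ A).natDegree → ℂ) :=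
    LinearMap.pi fun k => (C' ∘L A ^ (k : ℕ)).toLinearMap
  have hl : Function.Injective l := by
    rw [← LinearMap.ker_eq_bot, LinearMap.ker_eq_bot']
    intro x hx
    refine h.eq_zero_of_observations hA fun p hp => ?_
    rcases eq_or_ne p 0 with rfl | hp0
    · simp
    rw [aeval_eq_sum_range' ((natDegree_lt_iff_degree_lt hp0).2 hp), sum_apply, map_sum]
    refine Finset.sum_eq_zero fun k hk => ?_
    have := congrFun hx ⟨k, Finset.mem_range.1 hk⟩
    rw [smul_apply, map_smul]
    have h2 : C' ((A ^ k) x) = 0 := this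
    rw [h2, smul_zero]
  simpa using LinearMap.finrank_le_finrank_of_injective hl

/-- The function `s ↦ C (s - A)⁻¹ x` has finitely many zeros. -/
lemma LyapunovEq.finite_zeros (h : LyapunovEq A C') (hA : IsStable A) {x : X} (hx : x ≠ 0) :
    {s : ℂ | s ∉ spectrum ℂ A ∧ C' (resolvent A s x) = 0}.Finite := by
  by_contra hinf
  obtain ⟨t, htS, htcard⟩ := Set.Infinite.exists_subset_card_eq hinf (minpoly ℂ A).natDegree
  -- With `N` the monic polynomial whose roots are the assumed zeros, put `x = N(A) y`. Each zero
  -- `i` gives `C (N / (X - i))(A) y = 0`, and by Lagrange interpolation these quotients span the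
  -- polynomials of degree below that of the minimal polynomial.
  have hN : IsUnit (aeval A (Lagrange.nodal t id)) :=
    isUnit_aeval_prod t id fun i hi => (htS hi).1
  obtain ⟨y, hy⟩ := exists_of_isUnit hN x
  have hnode : ∀ i ∈ t, C' (aeval A (Lagrange.nodal (t.erase i) id) y) = 0 := fun i hi => by
    have h1 : x = -(i • aeval A (Lagrange.nodal (t.erase i) id) y -
        A (aeval A (Lagrange.nodal (t.erase i) id) y)) := by
      rw [← hy, Lagrange.nodal_eq_mul_nodal_erase hi, map_mul, mul_apply_eq_comp]
      simp [Algebra.algebraMap_eq_smul_one]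
    have h2 := (htS hi).2
    rw [h1, map_neg, resolvent_apply_sub (htS hi).1, map_neg, neg_eq_zero] at h2
    exact h2
  have hy0 : y = 0 := h.eq_zero_of_observations hA fun p hp => by
    rw [Lagrange.eq_interpolate (s := t) (v := id) (f := p) (Set.injOn_id _) (by rwa [htcard]),
      Lagrange.interpolate_apply, map_sum, sum_apply, map_sum]
    refine Finset.sum_eq_zero fun i hi => ?_
    rw [Lagrange.basis_eq_prod_sub_inv_mul_nodal_div hi, Lagrange.nodal_erase_eq_nodal_div hi
      |>.symm, ← mul_assoc, ← C_mul, map_mul, aeval_C, mul_apply_eq_comp,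
      Algebra.algebraMap_eq_smul_one, smul_apply, one_apply_eq_self, map_smul, hnode i hi,
      smul_zero]
  rw [hy0, map_zero] at hy
  exact hx hy.symm

/-- A self-adjoint operator of rank one has the form `v ↦ c ⟨e, v⟩ e` with `c` real and `e` a unit
vector; here `c ≤ 0`, so `C = √(-c) ⟨e, ·⟩` works. -/
lemma exists_lyapunovEq (hdiss : IsDissipative A)
    (hrank : Module.finrank ℂ (LinearMap.range
      (ContinuousLinearMap.adjoint A + A : X →L[ℂ] X).toLinearMap) = 1) :
    ∃ C' : X →L[ℂ] ℂ, LyapunovEq A C' := by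
  set M : X →L[ℂ] X := ContinuousLinearMap.adjoint A + A with hM
  have hsa : ∀ v w, inner ℂ (M v) w = inner ℂ v (M w) := fun v w => by
    simp only [hM, add_apply, inner_add_left, inner_add_right,
      ContinuousLinearMap.adjoint_inner_left, ContinuousLinearMap.adjoint_inner_right]
    ring
  obtain ⟨e0, he0, hspan0⟩ := finrank_eq_one_iff'.1 hrank
  have he0' : (e0 : X) ≠ 0 := by simpa using he0
  set e : X := ((‖(e0 : X)‖⁻¹ : ℝ) : ℂ) • (e0 : X) with he
  have hnorm : ‖e‖ = 1 := by
    rw [he, norm_smul, Complex.norm_real, norm_inv, norm_norm,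
      inv_mul_cancel₀ (norm_ne_zero_iff.2 he0')]
  have hee : inner ℂ e e = (1 : ℂ) := by rw [inner_self_eq_norm_sq_to_K, hnorm]; simp
  have hspan : ∀ v, ∃ c : ℂ, M v = c • e := fun v => by
    obtain ⟨c, hc⟩ := hspan0 ⟨M v, v, rfl⟩
    refine ⟨c * ‖(e0 : X)‖, ?_⟩
    have h1 : c • (e0 : X) = M v := congrArg Subtype.val hc
    rw [← h1, he, smul_smul, mul_assoc, ← Complex.ofReal_mul,
      mul_inv_cancel₀ (norm_ne_zero_iff.2 he0'), Complex.ofReal_one, mul_one]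
  clear_value e
  obtain ⟨c, hc⟩ := hspan e
  have hform : ∀ v, M v = (c * inner ℂ e v) • e := fun v => by
    obtain ⟨b, hb⟩ := hspan v
    have h1 := hsa v e
    have h2 := hsa e v
    rw [hb, hc, inner_smul_left, inner_smul_right, hee, mul_one] at h2
    have h3 := hsa e e
    rw [hc, inner_smul_left, inner_smul_right, hee, mul_one, mul_one] at h3
    rw [hb, ← h2, h3]
  have hcim : c.im = 0 := by
    have h3 := hsa e e
    rw [hc, inner_smul_left, inner_smul_right, hee, mul_one, mul_one] at h3
    exact Complex.conj_eq_iff_im.1 h3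
  have hcre : c.re ≤ 0 := by
    have h1 := (ContinuousLinearMap.nonneg_iff_isPositive _).1 (sub_nonneg.2 hdiss)
    have h2 := h1.re_inner_nonneg_right e
    rw [zero_sub, neg_apply, ← hM, hc, inner_neg_right, inner_smul_right, hee] at h2
    simpa using h2
  refine ⟨((Real.sqrt (-c.re) : ℝ) : ℂ) • innerSL ℂ e, ?_⟩
  rw [LyapunovEq, ← hM]
  ext v
  refine ext_inner_left ℂ fun w => ?_
  rw [hform v, neg_apply, ContinuousLinearMap.comp_apply, inner_neg_right,
    ContinuousLinearMap.adjoint_inner_right, inner_smul_right]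
  simp only [smul_apply, innerSL_apply_apply, smul_eq_mul, RCLike.inner_apply, map_mul,
    Complex.conj_ofReal, inner_conj_symm]
  have h1 : ((Real.sqrt (-c.re) : ℝ) : ℂ) * ((Real.sqrt (-c.re) : ℝ) : ℂ) = -c := by
    rw [← Complex.ofReal_mul, Real.mul_self_sqrt (by linarith)]
    apply Complex.ext <;> simp [hcim]
  linear_combination (inner ℂ e v * inner ℂ w e) * h1

end Operators

/-! ### Scalar uniqueness by the maximum principle. -/

lemma ne_zero_of_mem_rightHalfPlane {s a : ℂ} (hs : 0 ≤ s.re) (ha : a.re < 0) : s - a ≠ 0 := by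
  intro h
  have := congrArg Complex.re h
  simp only [Complex.sub_re, Complex.zero_re] at this
  linarith

/-- An analytic function on the half plane whose real part is at most `δ`, for every `δ > 0`,
outside a compact subset, vanishes identically if it has a zero. -/
lemma eqOn_zero_of_re_lt_off_compact {F : ℂ → ℂ} (hF : DifferentiableOn ℂ F rightHalfPlane)
    (hK : ∀ δ > 0, IsCompact {s | s ∈ rightHalfPlane ∧ δ ≤ (F s).re})
    {a : ℂ} (ha : a ∈ rightHalfPlane) (hFa : F a = 0) : Set.EqOn F 0 rightHalfPlane := by
  have hpre : IsPreconnected rightHalfPlane := convex_rightHalfPlane.isPreconnected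
  have hle : ∀ s ∈ rightHalfPlane, (F s).re ≤ 0 := by
    by_contra! hcon
    obtain ⟨s₀, hs₀, hpos⟩ := hcon
    obtain ⟨m, hm, hmax⟩ := (hK _ hpos).exists_isMaxOn ⟨s₀, hs₀, le_rfl⟩
      (Complex.continuous_re.comp_continuousOn (hF.continuousOn.mono fun s hs => hs.1))
    -- A positive value of `Re F` would make `|exp F|` attain its maximum, hence `exp F` constant,
    -- although `|exp F| = 1` at `a`.
    have hmax' : IsMaxOn (norm ∘ fun s => Complex.exp (F s)) rightHalfPlane m := fun s hs => by
      simp only [Set.mem_ofPred_eq, Function.comp_apply, Complex.norm_exp]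
      refine Real.exp_le_exp.2 ?_
      by_cases h : (F s₀).re ≤ (F s).re
      · exact hmax ⟨hs, h⟩
      · exact (not_le.1 h).le.trans hm.2
    have := Complex.eqOn_of_isPreconnected_of_isMaxOn_norm hpre isOpen_rightHalfPlane
      hF.cexp hm.1 hmax' ha
    have h2 := congrArg norm this
    simp only [Function.const_apply, Complex.norm_exp, Real.exp_eq_exp, hFa,
      Complex.zero_re] at h2
    have := hm.2
    linarith
  have hre : ∀ s ∈ rightHalfPlane, 1 ≤ ‖1 - F s‖ := fun s hs => by
    have h1 := Complex.re_le_norm (1 - F s)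
    have h2 := hle s hs
    simp only [Complex.sub_re, Complex.one_re] at h1
    linarith
  have hne : ∀ s ∈ rightHalfPlane, 1 - F s ≠ 0 := fun s hs =>
    norm_pos_iff.1 (one_pos.trans_le (hre s hs))
  -- Now `Re F ≤ 0`, so `|1 / (1 - F)| ≤ 1` with equality at `a`.
  have hmax : IsMaxOn (norm ∘ fun s => (1 - F s)⁻¹) rightHalfPlane a := fun s hs => by
    simpa [hFa] using inv_le_one_of_one_le₀ (hre s hs)
  intro s hs
  have h1 := Complex.eqOn_of_isPreconnected_of_isMaxOn_norm hpre isOpen_rightHalfPlane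
    ((hF.const_sub 1).inv hne) ha hmax hs
  simpa [hFa] using h1

lemma norm_add_conj_eq_of_re_eq_zero {s : ℂ} (hs : s.re = 0) (a : ℂ) :
    ‖s + conj a‖ = ‖s - a‖ := by
  rw [← Complex.norm_conj (s + conj a), map_add, Complex.conj_conj, ← norm_neg (s - a)]
  congr 1
  apply Complex.ext <;> simp [hs]
  ring

lemma mul_add_conj_of_re_eq_zero {s : ℂ} (hs : s.re = 0) (a : ℂ) :
    (s - a) * (s + conj a) = -((‖s - a‖ ^ 2 : ℝ) : ℂ) := by
  rw [Complex.sq_norm, Complex.normSq_apply]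
  apply Complex.ext <;> simp [hs] <;> ring

lemma tendsto_add_div_add_cobounded (u v : ℂ) :
    Tendsto (fun s : ℂ => (s + u) / (s + v)) (Bornology.cobounded ℂ) (𝓝 1) := by
  have h1 : Tendsto (fun s : ℂ => (s + v)⁻¹) (Bornology.cobounded ℂ) (𝓝 0) :=
    tendsto_inv₀_cobounded.comp (tendsto_add_const_cobounded v)
  have h2 : Tendsto (fun s : ℂ => 1 + (u - v) * (s + v)⁻¹) (Bornology.cobounded ℂ) (𝓝 1) := by
    simpa using (h1.const_mul (u - v)).const_add 1
  refine h2.congr' ?_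
  have : ∀ᶠ s in Bornology.cobounded ℂ, s ≠ -v := 
    Bornology.isCobounded_def.1 (Bornology.IsBounded.compl (Bornology.isBounded_singleton (x := -v)))
  filter_upwards [this] with s hs
  have : s + v ≠ 0 := fun h => hs (eq_neg_of_add_eq_zero_left h)
  field_simp
  ring

lemma BlaschkeProduct.eval_mul_denPoly (φ : BlaschkeProduct) {s : ℂ} (hs : 0 ≤ s.re) :
    (denPoly φ.pole).eval s * φ.eval s = φ.rho * (numPoly φ.pole).eval s := by
  have h : ∏ k, (s - φ.pole k) ≠ 0 := Finset.prod_ne_zero_iff.2 fun k _ =>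
    ne_zero_of_mem_rightHalfPlane hs (φ.pole_re_neg k)
  rw [eval_denPoly, eval_numPoly, BlaschkeProduct.eval, Finset.prod_div_distrib]
  field_simp

lemma BlaschkeProduct.differentiableOn_eval (φ : BlaschkeProduct) :
    DifferentiableOn ℂ φ.eval rightHalfPlane := by
  refine DifferentiableOn.const_mul (DifferentiableOn.fun_finsetProd fun k _ => ?_) _
  exact (differentiableOn_id.add_const _).div (differentiableOn_id.sub_const _) fun s hs =>
    ne_zero_of_mem_rightHalfPlane (le_of_lt hs) (φ.pole_re_neg k)

/-- The bound `‖q² / (m m#)‖ - Re (q q# / (m m#))` for the real part of the auxiliary function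
in the uniqueness theorem. -/
noncomputable def boundaryDefect {d : ℕ} (α a : Fin d → ℂ) (s : ℂ) : ℝ :=
  ‖∏ k, ((s - α k) ^ 2 / ((s - a k) * (s + conj (a k))))‖ -
    (∏ k, ((s - α k) * (s + conj (α k)) / ((s - a k) * (s + conj (a k))))).re

lemma tendsto_boundaryDefect_cobounded {d : ℕ} (α a : Fin d → ℂ) :
    Tendsto (boundaryDefect α a) (Bornology.cobounded ℂ) (𝓝 0) := by
  have key : ∀ u v : Fin d → ℂ, Tendsto (fun s : ℂ =>
      ∏ k, ((s + u k) * (s + v k) / ((s - a k) * (s + conj (a k))))) (Bornology.cobounded ℂ)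
      (𝓝 1) := fun u v => by
    have : ∀ k ∈ (Finset.univ : Finset (Fin d)), Tendsto
        (fun s : ℂ => ((s + u k) * (s + v k) / ((s - a k) * (s + conj (a k)))))
        (Bornology.cobounded ℂ) (𝓝 1) := fun k _ => by
      have := (tendsto_add_div_add_cobounded (u k) (-a k)).mul
        (tendsto_add_div_add_cobounded (v k) (conj (a k)))
      simpa only [div_mul_div_comm, ← sub_eq_add_neg, mul_one] using this
    simpa using tendsto_finsetProd _ this
  have h1 := (key (fun k => -α k) (fun k => -α k)).norm
  have h2 := (Complex.continuous_re.tendsto _).comp (key (fun k => -α k) (fun k => conj (α k)))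
  have := h1.sub h2
  simp only [norm_one, Complex.one_re, sub_self, Function.comp_def, ← sub_eq_add_neg,
    ← pow_two] at this
  exact this

/-- On the imaginary axis `s + conj α = -conj (s - α)`, so both products equal `∏ |s - α_k|² / |s -
a_k|²`. -/
lemma boundaryDefect_eq_zero {d : ℕ} (α a : Fin d → ℂ) {s : ℂ} (hs : s.re = 0) :
    boundaryDefect α a s = 0 := by
  have h1 : ∀ k, (s - α k) * (s + conj (α k)) / ((s - a k) * (s + conj (a k))) =
      ((‖s - α k‖ ^ 2 / ‖s - a k‖ ^ 2 : ℝ) : ℂ) := fun k => by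
    rw [mul_add_conj_of_re_eq_zero hs, mul_add_conj_of_re_eq_zero hs, neg_div_neg_eq]
    push_cast
    rfl
  have h2 : ∀ k, ‖(s - α k) ^ 2 / ((s - a k) * (s + conj (a k)))‖ =
      ‖s - α k‖ ^ 2 / ‖s - a k‖ ^ 2 := fun k => by
    rw [norm_div, norm_mul, norm_pow, norm_add_conj_eq_of_re_eq_zero hs, pow_two ‖s - a k‖]
  rw [boundaryDefect, norm_prod]
  simp only [h1, h2]
  rw [← Complex.ofReal_prod, Complex.ofReal_re, sub_self]

lemma continuousAt_boundaryDefect {d : ℕ} (α : Fin d → ℂ) {a : Fin d → ℂ}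
    (ha : ∀ k, a k ∈ rightHalfPlane) {s : ℂ} (hs : s.re = 0) :
    ContinuousAt (boundaryDefect α a) s := by
  have hne : ∀ k, (s - a k) * (s + conj (a k)) ≠ 0 := fun k => by
    have h0 : 0 < (a k).re := ha k
    refine mul_ne_zero (fun h => ?_) fun h => ?_ <;>
    · have := congrArg Complex.re h
      simp [hs] at this
      linarith
  have hden : ∀ k, ContinuousAt (fun z => (z - a k) * (z + conj (a k))) s := fun k => by fun_prop
  have key : ∀ f : Fin d → ℂ → ℂ, (∀ k, Continuous (f k)) → ContinuousAt
      (fun z => ∏ k, (f k z / ((z - a k) * (z + conj (a k))))) s := fun f hf =>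
    tendsto_finsetProd _ fun k _ => ((hf k).continuousAt.div (hden k) (hne k)).tendsto
  exact (key _ fun k => by fun_prop).norm.sub
    (Complex.continuous_re.continuousAt.comp (key _ fun k => by fun_prop))

/-- A function in the unit ball of `H^∞` which agrees with a Blaschke product of degree `d` at
`d + 1` points, counted with multiplicity, is equal to it. -/
theorem BlaschkeProduct.eqOn_of_sub_eq_mul (φ : BlaschkeProduct) {θ h : ℂ → ℂ}
    (hθ : ∀ s ∈ rightHalfPlane, ‖θ s‖ ≤ 1) (hh : DifferentiableOn ℂ h rightHalfPlane)
    {a : Fin φ.deg → ℂ} (ha : ∀ k, a k ∈ rightHalfPlane) {b : ℂ} (hb : b ∈ rightHalfPlane)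
    (hsub : ∀ s ∈ rightHalfPlane, θ s - φ.eval s = (∏ k, (s - a k)) * ((s - b) * h s)) :
    Set.EqOn θ φ.eval rightHalfPlane := by
  -- With `m = ∏ (s - a_k)` and `m# = ∏ (s + conj a_k)`, this is `(conj ρ θ q² - q p) / (m m#)`,
  -- freed of its poles at the `a_k`. It vanishes at the extra node `b`.
  set F : ℂ → ℂ := fun s =>
    conj φ.rho * ((s - b) * h s) * ∏ k, ((s - φ.pole k) ^ 2 / (s + conj (a k))) with hFdef
  have hne : ∀ s ∈ rightHalfPlane, ∀ k, s + conj (a k) ≠ 0 := fun s hs k h0 => by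
    have h1 : 0 < s.re := hs
    have h2 : 0 < (a k).re := ha k
    have := congrArg Complex.re h0
    simp at this
    linarith
  have hF : DifferentiableOn ℂ F rightHalfPlane := by
    refine DifferentiableOn.mul
      (((differentiableOn_id.sub_const b).mul hh).const_mul _)
      (DifferentiableOn.fun_finsetProd fun k _ => ?_)
    exact ((differentiableOn_id.sub_const _).pow 2).div (differentiableOn_id.add_const _)
      fun s hs => hne s hs k
  have hrho : conj φ.rho * φ.rho = 1 := by
    rw [mul_comm, Complex.mul_conj, Complex.normSq_eq_norm_sq, φ.norm_rho]
    simp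
  have hFle : ∀ s ∈ rightHalfPlane, (∀ k, s ≠ a k) →
      (F s).re ≤ boundaryDefect φ.pole a s := fun s hs hsa => by
    have hne1 : ∏ k, (s - a k) ≠ 0 :=
      Finset.prod_ne_zero_iff.2 fun k _ => sub_ne_zero.2 (hsa k)
    have hne2 : ∏ k, (s + conj (a k)) ≠ 0 := Finset.prod_ne_zero_iff.2 fun k _ => hne s hs k
    have hφ := φ.eval_mul_denPoly (le_of_lt hs)
    rw [eval_denPoly, eval_numPoly] at hφ
    have hFs : F s =
        conj φ.rho * θ s * ∏ k, ((s - φ.pole k) ^ 2 / ((s - a k) * (s + conj (a k)))) -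
        ∏ k, ((s - φ.pole k) * (s + conj (φ.pole k)) / ((s - a k) * (s + conj (a k)))) := by
      have h1 : (s - b) * h s = (θ s - φ.eval s) / ∏ k, (s - a k) := by
        rw [hsub s hs]
        field_simp
      simp only [hFdef]
      rw [h1]
      simp only [Finset.prod_div_distrib, Finset.prod_mul_distrib, Finset.prod_pow]
      field_simp
      linear_combination (-conj φ.rho * ∏ k, (s - φ.pole k)) * hφ -
        ((∏ k, (s - φ.pole k)) * ∏ k, (s + conj (φ.pole k))) * hrho
    rw [hFs, Complex.sub_re, boundaryDefect]
    refine sub_le_sub_right ((Complex.re_le_norm _).trans ?_) _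
    rw [norm_mul, norm_mul, Complex.norm_conj, φ.norm_rho, one_mul]
    exact mul_le_of_le_one_left (norm_nonneg _) (hθ s hs)
  have hfin : (Set.range a).Finite := Set.finite_range a
  -- The defect tends to zero at the imaginary axis and at infinity, so the superlevel sets of `Re
  -- F` stay away from both. The nodes `a_k`, where the bound is not available, form a finite set
  -- inside the half plane.
  have hFzero := eqOn_zero_of_re_lt_off_compact hF (fun δ hδ => by
    rw [Metric.isCompact_iff_isClosed_bounded]
    refine ⟨isClosed_of_closure_subset fun s hs => ?_, ?_⟩
    · have hre : 0 ≤ s.re := closure_lt_subset_le continuous_const Complex.continuous_re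
        (closure_mono (fun z hz => hz.1) hs)
      have hfr := mem_closure_iff_frequently.1 hs
      rcases hre.eq_or_lt with h0 | hpos
      · exfalso
        have h1 : ∀ᶠ z in 𝓝 s, boundaryDefect φ.pole a z < δ :=
          (continuousAt_boundaryDefect φ.pole ha h0.symm).eventually_lt_const
            (by rwa [boundaryDefect_eq_zero _ _ h0.symm])
        have h2 : ∀ᶠ z in 𝓝 s, z ∉ Set.range a :=
          hfin.isClosed.isOpen_compl.mem_nhds fun ⟨k, hk⟩ => by
            have : 0 < (a k).re := ha k
            rw [hk] at this
            linarith
        obtain ⟨z, ⟨hz1, hz2⟩, hz3, hz4⟩ := (hfr.and_eventually (h1.and h2)).exists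
        have := hFle z hz1 fun k hk => hz4 ⟨k, hk.symm⟩
        linarith
      · refine ⟨hpos, ?_⟩
        have hc : ContinuousAt (fun z => (F z).re) s := Complex.continuous_re.continuousAt.comp
          (hF.differentiableAt (isOpen_rightHalfPlane.mem_nhds hpos)).continuousAt
        by_contra! hlt
        obtain ⟨z, hz1, hz2⟩ := (hfr.and_eventually (hc.eventually_lt_const hlt)).exists
        exact absurd hz1.2 (not_le.2 hz2)
    · have h1 := (tendsto_boundaryDefect_cobounded φ.pole a).eventually_lt_const hδ
      have h2 : Bornology.IsBounded ({s | boundaryDefect φ.pole a s < δ}ᶜ ∪ Set.range a) :=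
        (Bornology.isBounded_compl_iff.2 (Bornology.isCobounded_def.2 h1)).union hfin.isBounded
      refine h2.subset fun s hs => ?_
      by_contra hcon
      simp only [Set.mem_union, Set.mem_compl_iff, Set.mem_ofPred_eq, not_or, not_not] at hcon
      have := hFle s hs.1 fun k hk => hcon.2 ⟨k, hk.symm⟩
      linarith [hs.2]) hb (by simp [hFdef])
  intro s hs
  have h1 := hFzero hs
  have h2 : ∏ k, ((s - φ.pole k) ^ 2 / (s + conj (a k))) ≠ 0 :=
    Finset.prod_ne_zero_iff.2 fun k _ => div_ne_zero
      (pow_ne_zero 2 (ne_zero_of_mem_rightHalfPlane (le_of_lt hs) (φ.pole_re_neg k))) (hne s hs k)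
  have h3 : conj φ.rho ≠ 0 := left_ne_zero_of_mul_eq_one hrho
  simp only [hFdef, Pi.zero_apply, mul_eq_zero, h2, h3, or_false, false_or] at h1
  rw [← sub_eq_zero, hsub s hs, mul_eq_zero, mul_eq_zero]
  exact Or.inr h1

/-! ### Divisibility by the minimal polynomial and operator uniqueness. -/

/-- Division with remainder of an analytic function by a polynomial with given roots. -/
lemma exists_eq_add_prod_mul (L : List ℂ) (hL : ∀ a ∈ L, a ∈ rightHalfPlane) {g : ℂ → ℂ}
    (hg : DifferentiableOn ℂ g rightHalfPlane) :
    ∃ (r : ℂ[X]) (h : ℂ → ℂ), r.degree < L.length ∧ DifferentiableOn ℂ h rightHalfPlane ∧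
      ∀ s, g s = r.eval s + (L.map fun a => s - a).prod * h s := by
  induction L generalizing g with
  | nil => exact ⟨0, g, by simp, hg, fun s => by simp⟩
  | cons a L ih =>
    have ha : rightHalfPlane ∈ 𝓝 a :=
      isOpen_rightHalfPlane.mem_nhds (hL a List.mem_cons_self)
    obtain ⟨r, h, hr, hh, hgr⟩ := ih (fun b hb => hL b (List.mem_cons_of_mem _ hb))
      ((Complex.differentiableOn_dslope ha).2 hg)
    refine ⟨C (g a) + (Polynomial.X - C a) * r, h, ?_, hh, fun s => ?_⟩
    · refine (degree_add_le _ _).trans_lt (max_lt (degree_C_le.trans_lt ?_) ?_)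
      · simp only [List.length_cons]
        exact_mod_cast Nat.succ_pos _
      · rcases eq_or_ne r 0 with rfl | hr0
        · simp only [mul_zero, degree_zero]
          exact WithBot.bot_lt_coe _
        · rw [degree_eq_natDegree (mul_ne_zero (X_sub_C_ne_zero a) hr0),
            natDegree_mul (X_sub_C_ne_zero a) hr0, natDegree_X_sub_C]
          have := (natDegree_lt_iff_degree_lt hr0).2 hr
          simp only [List.length_cons]
          exact_mod_cast (by omega : 1 + r.natDegree < L.length + 1)
    · have h1 : g s = g a + (s - a) * dslope g a s := by
        have := sub_smul_dslope g a s
        rw [smul_eq_mul] at this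
        rw [this]
        ring
      rw [h1, hgr s]
      simp only [eval_add, eval_mul, eval_sub, eval_X, eval_C, List.map_cons, List.prod_cons]
      ring

lemma MemHInfty.norm_le_one {θ : ℂ → ℂ} (hθ : MemHInfty θ) (h1 : hInftyNorm θ ≤ 1) :
    ∀ s ∈ rightHalfPlane, ‖θ s‖ ≤ 1 := fun _ hs =>
  (le_csSup hθ.2 (Set.mem_image_of_mem _ hs)).trans h1

lemma mem_spectrum_of_isRoot_minpoly {𝔸 : Type*} [Ring 𝔸] [Algebra ℂ 𝔸] {T : 𝔸}
    (hT : IsIntegral ℂ T) {a : ℂ} (ha : (minpoly ℂ T).IsRoot a) : a ∈ spectrum ℂ T := by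
  by_contra hns
  obtain ⟨q, hq⟩ := dvd_iff_isRoot.2 ha
  have hu : IsUnit (aeval T (Polynomial.X - C a)) := by
    simpa using isUnit_aeval_prod {a} id (T := T) (by simpa using hns)
  have h0 : aeval T q = 0 := by
    have := minpoly.aeval ℂ T
    rwa [hq, map_mul, hu.mul_right_eq_zero] at this
  have hq0 : q ≠ 0 := by
    rintro rfl
    exact minpoly.ne_zero hT (by rw [hq, mul_zero])
  have h1 := natDegree_le_of_dvd (minpoly.dvd ℂ T h0) hq0
  rw [hq, natDegree_mul (X_sub_C_ne_zero a) hq0, natDegree_X_sub_C] at h1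
  omega

lemma BlaschkeProduct.isUnit_aeval_denPoly {𝔸 : Type*} [Ring 𝔸] [Algebra ℂ 𝔸] (φ : BlaschkeProduct)
    {B : 𝔸} (hB : spectrum ℂ B ⊆ rightHalfPlane) : IsUnit (aeval B (denPoly φ.pole)) :=
  isUnit_aeval_prod _ _ fun k _ hk => by
    have h1 : 0 < (φ.pole k).re := hB hk
    linarith [φ.pole_re_neg k]

section Operators

variable {X : Type*} [NormedAddCommGroup X] [InnerProductSpace ℂ X] [CompleteSpace X]
  [FiniteDimensional ℂ X]

/-- An analytic function annihilating `T` is divisible by the minimal polynomial of `T`. -/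
lemma exists_eq_prod_mul_of_opEval_eq_zero {T : X →L[ℂ] X} (hT : spectrum ℂ T ⊆ rightHalfPlane)
    {g : ℂ → ℂ} (hg : DifferentiableOn ℂ g rightHalfPlane) (h0 : opEval g T = 0) :
    ∃ (L : List ℂ) (h : ℂ → ℂ), L.length = (minpoly ℂ T).natDegree ∧
      (∀ a ∈ L, a ∈ rightHalfPlane) ∧ DifferentiableOn ℂ h rightHalfPlane ∧
      ∀ s, g s = (L.map fun a => s - a).prod * h s := by
  have hint := isIntegral_continuousLinearMap T
  have hmon := minpoly.monic hint
  have hsplit : (minpoly ℂ T).Splits := IsAlgClosed.splits _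
  set L := (minpoly ℂ T).roots.toList with hLdef
  have hlen : L.length = (minpoly ℂ T).natDegree := by
    rw [hLdef, Multiset.length_toList, hsplit.natDegree_eq_card_roots]
  have heval : ∀ s, (minpoly ℂ T).eval s = (L.map fun a => s - a).prod := fun s => by
    conv_lhs => rw [hsplit.eq_prod_roots_of_monic hmon]
    rw [eval_multiset_prod, Multiset.map_map, ← Multiset.prod_coe, ← Multiset.map_coe, hLdef,
      Multiset.coe_toList]
    simp
  have hL : ∀ a ∈ L, a ∈ rightHalfPlane := fun a ha => hT (mem_spectrum_of_isRoot_minpoly hint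
    (isRoot_of_mem_roots (Multiset.mem_toList.1 ha)))
  obtain ⟨r, h, hr, hh, hgr⟩ := exists_eq_add_prod_mul L hL hg
  -- Both `g` and the multiple of the minimal polynomial vanish at `T`, hence so does the remainder,
  -- whose degree is too small.
  have hrT : aeval T r = 0 := by
    have h1 : opEval g T = opEval (fun s => r.eval s + (minpoly ℂ T).eval s * h s) T :=
      opEval_congr hT fun s _ => by rw [hgr s, heval s]
    have h2 := opEval_add hT (f := fun s => r.eval s)
      (g := fun s => (minpoly ℂ T).eval s * h s) r.differentiable.differentiableOn
      ((minpoly ℂ T).differentiable.differentiableOn.mul hh)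
    rw [h0, h2, opEval_polynomial hT, opEval_polynomial_mul hT _ hh, minpoly.aeval, zero_mul,
      add_zero] at h1
    exact h1.symm
  have hr0 : r = 0 := by
    by_contra hne
    have h1 := minpoly.degree_le_of_ne_zero ℂ T hne hrT
    rw [degree_eq_natDegree hmon.ne_zero, ← hlen] at h1
    exact absurd hr (not_lt.2 h1)
  refine ⟨L, h, hlen, hL, hh, fun s => ?_⟩
  rw [hgr s, hr0, eval_zero, zero_add]

lemma LyapunovEq.finrank_le_natDegree_minpoly_neg {A : X →L[ℂ] X} {C' : X →L[ℂ] ℂ}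
    (h : LyapunovEq A C') (hA : IsStable A) :
    Module.finrank ℂ X ≤ (minpoly ℂ (-A)).natDegree := by
  refine (h.finrank_le_natDegree_minpoly hA).trans ?_
  have h1 : aeval A ((minpoly ℂ (-A)).comp (-Polynomial.X)) = 0 := by
    rw [aeval_comp, map_neg, aeval_X, minpoly.aeval]
  have hdeg : ((minpoly ℂ (-A)).comp (-Polynomial.X)).natDegree = (minpoly ℂ (-A)).natDegree := by
    rw [natDegree_comp, natDegree_neg, natDegree_X, mul_one]
  have hne : (minpoly ℂ (-A)).comp (-Polynomial.X) ≠ 0 := fun h0 => by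
    have h2 := congrArg (fun p : ℂ[X] => p.comp (-Polynomial.X)) h0
    simp only [comp_assoc, neg_comp, X_comp, neg_neg, comp_X, zero_comp] at h2
    exact minpoly.ne_zero (isIntegral_continuousLinearMap (-A)) h2
  rw [← hdeg]
  exact natDegree_le_of_dvd (minpoly.dvd ℂ A h1) hne

/-- Uniqueness in the degenerate interpolation problem. -/
theorem eqOn_of_opEval_eq {A : X →L[ℂ] X} {C' : X →L[ℂ] ℂ} (h : LyapunovEq A C')
    (hA : IsStable A) (φ : BlaschkeProduct) (hdeg : φ.deg < Module.finrank ℂ X) {θ : ℂ → ℂ}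
    (hθ : DifferentiableOn ℂ θ rightHalfPlane) (hθ1 : ∀ s ∈ rightHalfPlane, ‖θ s‖ ≤ 1)
    (heq : opEval θ (-A) = opEval φ.eval (-A)) : Set.EqOn θ φ.eval rightHalfPlane := by
  have hT := hA.neg_spectrum_subset
  have h0 : opEval (fun s => θ s + -1 * φ.eval s) (-A) = 0 := by
    rw [opEval_add hT hθ (φ.differentiableOn_eval.const_mul _), opEval_const_mul hT, heq,
      neg_one_smul, add_neg_cancel]
  obtain ⟨L, f, hlen, hL, hf, hgf⟩ := exists_eq_prod_mul_of_opEval_eq_zero hT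
    (hθ.add (φ.differentiableOn_eval.const_mul _)) h0
  have hlong : φ.deg < L.length :=
    hlen ▸ hdeg.trans_le (h.finrank_le_natDegree_minpoly_neg hA)
  -- The first `d` roots serve as `a`, the next as `b`; the rest are absorbed into `h`.
  obtain ⟨a, ha⟩ : ∃ a : Fin φ.deg → ℂ, L.take φ.deg = List.ofFn a :=
    ⟨fun k => L[k], by
      refine List.ext_getElem (by simp; omega) fun i h1 h2 => by simp⟩
  obtain ⟨b, L', hL'⟩ := List.exists_cons_of_ne_nil (l := L.drop φ.deg) (by simpa using hlong)
  have hsplit : L = List.ofFn a ++ b :: L' := by rw [← ha, ← hL', List.take_append_drop]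
  rw [hsplit] at hL hgf
  refine φ.eqOn_of_sub_eq_mul hθ1 (h := fun s => (L'.map fun c => s - c).prod * f s)
    (DifferentiableOn.mul ?_ hf) (a := a) (fun k => hL _ (by simp)) (b := b) (hL b (by simp))
    fun s _ => ?_
  · have hpoly : (fun s => (L'.map fun c => s - c).prod) =
        fun s => ((L'.map fun c => Polynomial.X - C c).prod : ℂ[X]).eval s := by
      funext s
      simp [eval_list_prod, Function.comp_def]
    rw [hpoly]
    exact Polynomial.differentiableOn _
  · have := hgf s
    simp only [List.map_append, List.map_cons, List.prod_append, List.prod_cons, List.map_ofFn,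
      List.prod_ofFn, Function.comp_apply] at this
    rw [Pi.add_apply] at this
    linear_combination this

/-! ### Extremal vectors of `φ(-A*)` and the quotient formula. -/

section Extremal

variable {A : X →L[ℂ] X} {C' : X →L[ℂ] ℂ} (φ : BlaschkeProduct)

/-- Parametrising vectors as `q(B) v` turns `φ(B)` into a polynomial in `B`, so multiplicativity of
the calculus is needed only for polynomial factors. -/
lemma BlaschkeProduct.opEval_denPoly_apply {B : X →L[ℂ] X}
    (hB : spectrum ℂ B ⊆ rightHalfPlane) (v : X) :
    opEval φ.eval B (aeval B (denPoly φ.pole) v) = φ.rho • aeval B (numPoly φ.pole) v := by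
  have h1 : aeval B (denPoly φ.pole) * opEval φ.eval B = φ.rho • aeval B (numPoly φ.pole) := by
    rw [← opEval_polynomial_mul hB _ φ.differentiableOn_eval, ← opEval_polynomial hB,
      ← opEval_const_mul hB]
    exact opEval_congr hB fun s hs => φ.eval_mul_denPoly (le_of_lt hs)
  have h2 : aeval B (denPoly φ.pole) * (opEval φ.eval B * aeval B (denPoly φ.pole)) =
      aeval B (denPoly φ.pole) * (φ.rho • aeval B (numPoly φ.pole)) := by
    rw [← mul_assoc, h1, mul_smul_comm, smul_mul_assoc, ← map_mul, ← map_mul, mul_comm]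
  exact congrArg (fun S : X →L[ℂ] X => S v)
    ((φ.isUnit_aeval_denPoly hB).mul_right_injective h2)

lemma LyapunovEq.norm_opEval_le (h : LyapunovEq A C') (hA : IsStable A) (x : X) :
    ‖opEval φ.eval (-ContinuousLinearMap.adjoint A) x‖ ≤ ‖x‖ := by
  have hB := hA.adjoint.neg_spectrum_subset
  obtain ⟨v, rfl⟩ := exists_of_isUnit (φ.isUnit_aeval_denPoly hB) x
  rw [φ.opEval_denPoly_apply hB, norm_smul, φ.norm_rho, one_mul]
  exact le_of_sq_le_sq (h.norm_numPoly_le φ.pole φ.pole_re_neg v) (norm_nonneg _)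

lemma LyapunovEq.exists_extremal (h : LyapunovEq A C') (hA : IsStable A)
    (hdeg : φ.deg < Module.finrank ℂ X) :
    ∃ x : X, x ≠ 0 ∧ x = ContinuousLinearMap.adjoint
      (opEval φ.eval (-ContinuousLinearMap.adjoint A))
      (opEval φ.eval (-ContinuousLinearMap.adjoint A) x) := by
  have hB := hA.adjoint.neg_spectrum_subset
  obtain ⟨l, hl⟩ := h.exists_functionals φ.pole
  have hker : (LinearMap.pi l).ker ≠ ⊥ := LinearMap.ker_ne_bot_of_finrank_lt (by simpa using hdeg)
  obtain ⟨v, hv, hv0⟩ := Submodule.exists_mem_ne_zero_of_ne_bot hker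
  refine ⟨aeval (-ContinuousLinearMap.adjoint A) (denPoly φ.pole) v, fun h0 =>
    hv0 (injective_of_isUnit (φ.isUnit_aeval_denPoly hB) h0),
    eq_adjoint_apply_of_norm_eq (h.norm_opEval_le φ hA) ?_⟩
  rw [φ.opEval_denPoly_apply hB, norm_smul, φ.norm_rho, one_mul]
  exact (sq_eq_sq₀ (norm_nonneg _) (norm_nonneg _)).1 (hl v fun k => congrFun hv k)

lemma LyapunovEq.eval_eq_div (h : LyapunovEq A C') (hA : IsStable A) {x : X}
    (hx : x = ContinuousLinearMap.adjoint (opEval φ.eval (-ContinuousLinearMap.adjoint A))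
      (opEval φ.eval (-ContinuousLinearMap.adjoint A) x))
    {s : ℂ} (hs : s ∉ spectrum ℂ A) (hne : C' (resolvent A s x) ≠ 0) :
    φ.eval s = C' (resolvent A s (opEval φ.eval (-ContinuousLinearMap.adjoint A) x)) /
      C' (resolvent A s x) := by
  have hB := hA.adjoint.neg_spectrum_subset
  have hnorm := norm_eq_of_eq_adjoint_apply hx
  clear hx
  obtain ⟨v, rfl⟩ := exists_of_isUnit (φ.isUnit_aeval_denPoly hB) x
  rw [φ.opEval_denPoly_apply hB, norm_smul, φ.norm_rho, one_mul] at hnorm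
  have key := h.transfer_eq φ.pole φ.pole_re_neg hnorm hs
  rw [eval_denPoly, eval_numPoly] at key
  -- At a pole of `φ` the identity `key` would force `p(s) = 0` too, but `q` has its roots in the
  -- left half plane and `p` in the right one.
  have hden : ∏ k, (s - φ.pole k) ≠ 0 := fun h0 => by
    rw [h0, zero_mul, eq_comm, mul_eq_zero, or_iff_left hne] at key
    obtain ⟨i, -, hi⟩ := Finset.prod_eq_zero_iff.1 h0
    obtain ⟨j, -, hj⟩ := Finset.prod_eq_zero_iff.1 key
    have h1 := congrArg Complex.re hi
    have h2 := congrArg Complex.re hj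
    simp only [Complex.sub_re, Complex.add_re, Complex.conj_re, Complex.zero_re] at h1 h2
    linarith [φ.pole_re_neg i, φ.pole_re_neg j]
  rw [φ.opEval_denPoly_apply hB, map_smul, map_smul, smul_eq_mul, BlaschkeProduct.eval,
    Finset.prod_div_distrib, mul_div_assoc]
  congr 1
  rw [div_eq_div_iff hden hne]
  linear_combination -key

end Extremal

end Operators

end BlaschkeInterp

open BlaschkeInterp ContinuousLinearMap in
theorem proposition4p5 {X : Type*} [NormedAddCommGroup X] [InnerProductSpace ℂ X]
    [CompleteSpace X] [FiniteDimensional ℂ X]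
    (A : X →L[ℂ] X) (hstable : IsStable A) (hdiss : IsDissipative A)
    (hrank : Module.finrank ℂ (LinearMap.range (adjoint A + A : X →L[ℂ] X).toLinearMap) = 1)
    (φ : BlaschkeProduct) (hdeg : φ.deg < Module.finrank ℂ X) :
    -- operators `C` and nonzero vectors `x` as in the formula exist
    (∃ C : X →L[ℂ] ℂ, adjoint A + A = -(adjoint C ∘L C)) ∧
    (∃ x : X, x ≠ 0 ∧
      x = adjoint (opEval φ.eval (-adjoint A)) (opEval φ.eval (-adjoint A) x)) ∧
    -- for all of them the quotient formula holds, as an identity of rational functions of `s`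
    (∀ C : X →L[ℂ] ℂ, adjoint A + A = -(adjoint C ∘L C) →
      ∀ x : X, x ≠ 0 →
        x = adjoint (opEval φ.eval (-adjoint A)) (opEval φ.eval (-adjoint A) x) →
        {s : ℂ | s ∉ spectrum ℂ A ∧ C (resolvent A s x) = 0}.Finite ∧
        ∀ s : ℂ, s ∉ spectrum ℂ A → C (resolvent A s x) ≠ 0 →
          φ.eval s =
            C (resolvent A s (opEval φ.eval (-adjoint A) x)) / C (resolvent A s x)) ∧
    -- uniqueness
    (∀ θ : ℂ → ℂ, MemHInfty θ → opEval θ (-A) = opEval φ.eval (-A) → hInftyNorm θ ≤ 1 →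
      ∀ s ∈ rightHalfPlane, θ s = φ.eval s) := by
  obtain ⟨C₀, hC₀⟩ := exists_lyapunovEq hdiss hrank
  refine ⟨⟨C₀, hC₀⟩, hC₀.exists_extremal φ hstable hdeg, fun C hC x hx0 hx => ?_,
    fun θ hθ heq hle s hs => ?_⟩
  · have hC' : LyapunovEq A C := hC
    exact ⟨hC'.finite_zeros hstable hx0, fun s hs hne => hC'.eval_eq_div φ hstable hx hs hne⟩
  · exact eqOn_of_opEval_eq hC₀ hstable φ hdeg hθ.1 (hθ.norm_le_one hle) heq hs
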